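/- Let $0<\beta<2$, and let $X=\{X_t\}_{t\ge 0}$ be a real-valued symmetric $\beta$-stable Lévy process, that is, a process with stationary independent increments, $X_0=0$ a.s., and a.s. càdlàg paths, normalized so that $\mathrm{E}\exp(izX_t)=\exp(-t|z|^\beta)$ for every $t\ge 0$ and $z\in\mathbb{R}$. For every $\alpha>0$ let \[ \mathcal{H}_X(\alpha):=\left\{t\ge \mathrm{e}:\ X_t\ge t^{1/\beta}(\log_2 t)^\alpha\right\} \] be the (random) set of tall peaks of $X$. Then $\mathcal{H}_X(\alpha)$ is a.s. unbounded if $0<\alpha\le 1/\beta$, and it is a.s. bounded if $\alpha>1/\beta$. -/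

import Mathlib

open MeasureTheory ProbabilityTheory Filter Topology
open scoped NNReal

/-- A path `f : [0, ∞) → ℝ` is càdlàg: it is right-continuous at every point and has a (finite)
left limit at every point (the latter is automatic at time `0`). -/
def IsCadlagPath (f : ℝ≥0 → ℝ) : Prop :=
  ∀ t, ContinuousWithinAt f (Set.Ici t) t ∧ ∃ l : ℝ, Tendsto f (𝓝[<] t) (𝓝 l)

/-- `X = (X_t)_{t ≥ 0}` is a real-valued Lévy process under `P`: it starts from `0`, has
independent and stationary increments, and almost all of its paths are càdlàg. -/
structure IsLevyProcess {Ω : Type*} [MeasurableSpace Ω] (X : ℝ≥0 → Ω → ℝ) (P : Measure Ω) :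
    Prop where
  measurable : ∀ t, Measurable (X t)
  zero : ∀ᵐ ω ∂P, X 0 ω = 0
  indepIncrements : HasIndepIncrements X P
  stationaryIncrements : ∀ s t : ℝ≥0, IdentDistrib (fun ω ↦ X (s + t) ω - X s ω) (X t) P P
  cadlag : ∀ᵐ ω ∂P, IsCadlagPath (fun t ↦ X t ω)

/-- `X` is a (normalized) real-valued symmetric `β`-stable Lévy process: a Lévy process with
`E exp(i z X_t) = exp(-t |z| ^ β)` for all `t ≥ 0` and all real `z`. -/
structure IsSymmetricStableLevyProcess {Ω : Type*} [MeasurableSpace Ω] (β : ℝ)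
    (X : ℝ≥0 → Ω → ℝ) (P : Measure Ω) : Prop extends IsLevyProcess X P where
  charFun_eq : ∀ (t : ℝ≥0) (z : ℝ),
    charFun (P.map (X t)) z = ((Real.exp (-((t : ℝ) * |z| ^ β)) : ℝ) : ℂ)

/-- The set of tall peaks `{t ≥ e : f t ≥ t ^ (1/β) (log₂ t) ^ α}` of a path `f`. -/
def tallPeaks (β α : ℝ) (f : ℝ≥0 → ℝ) : Set ℝ≥0 :=
  {t | Real.exp 1 ≤ (t : ℝ) ∧ (t : ℝ) ^ (1 / β) * (Real.logb 2 (t : ℝ)) ^ α ≤ f t}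

/-!
The proof combines two-sided tail bounds for `X_t` with the Borel–Cantelli lemmas along `t = 2 ^ n`.

*Tails.* Both bounds are read off the characteristic function `exp (-t |z| ^ β)`. The upper bound
`P (|X_t| > r) ≤ C t r ^ (-β)` (`measureReal_abs_gt_le_of_charFun`) comes from averaging
`1 - charFun` over `|z| ≤ 2 / r`. For the lower bound (`le_measureReal_abs_gt_of_charFun`), with
`z = δ / r` one has pointwise
`1 - cos (z x) ≤ (π² / 4) δ² (1 - cos (x / r)) + 2 · 1_{|x| > r}`; after integration the first term
on the right is of order `δ ^ 2 t r ^ (-β)`, while the left side is of order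
`δ ^ β t r ^ (-β)`. As `β < 2`, for small `δ` the tail term has to make up for the difference.

*Bounded case.* Lévy's maximal inequality, proved for sums of independent variables
(`measure_exists_lt_sum_le`) and carried to continuous time by right-continuity along dyadic grids
(`IsSymmetricStableLevyProcess.measure_exists_le`), bounds the probability of a tall peak in
`[2 ^ n, 2 ^ (n + 1))` by a multiple of `n ^ (-α β)`, which is summable when `α > 1 / β`.

*Unbounded case.* It suffices to reach the heights for `α = 1 / β`. Let
`a n = (2 ^ n (n + 1)) ^ (1 / β)`. The independent increments over `[2 ^ n, 2 ^ (n + 1)]` exceed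
`K * a n` with probability at least `c / (n + 1)`, hence infinitely often. Such an increment
could only be spoiled by `X (2 ^ n) < -a n`, an independent event of probability `O (1 / n)`; the
two occur together with probability `O (1 / n ^ 2)`, hence only finitely often. With
`K = 1 + 2 ^ (1 / β)` every unspoiled large increment ends in a tall peak at time `2 ^ (n + 1)`.
-/

/-! ### Tails of the symmetric stable law -/

section StableLaw

variable {μ : Measure ℝ} [IsProbabilityMeasure μ] {β t : ℝ}

lemma integrable_one_sub_cos_mul (z : ℝ) : Integrable (fun x ↦ 1 - Real.cos (z * x)) μ := by
  refine Integrable.of_bound (by fun_prop) 2 (ae_of_all _ fun x ↦ ?_)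
  rw [Real.norm_eq_abs, abs_le]
  constructor <;> linarith [Real.cos_le_one (z * x), Real.neg_one_le_cos (z * x)]

lemma integral_one_sub_cos_mul (z : ℝ) :
    ∫ x, (1 - Real.cos (z * x)) ∂μ = 1 - (charFun μ z).re := by
  have hcos : Integrable (fun x ↦ Real.cos (z * x)) μ :=
    Integrable.of_bound (by fun_prop) 1 (ae_of_all _ fun x ↦ Real.abs_cos_le_one _)
  rw [integral_sub (integrable_const _) hcos, charFun_apply_real]
  have hint : Integrable (fun x : ℝ ↦ Complex.exp (z * x * Complex.I)) μ := by
    refine Integrable.of_bound (by fun_prop) 1 (ae_of_all _ fun x ↦ ?_)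
    rw [← Complex.ofReal_mul, Complex.norm_exp_ofReal_mul_I]
  have hre := Complex.reCLM.integral_comp_comm hint
  simp only [Complex.reCLM_apply] at hre
  rw [← hre]
  simp only [← Complex.ofReal_mul, Complex.exp_ofReal_mul_I_re]
  simp

lemma map_neg_eq_of_charFun
    (hμ : ∀ z : ℝ, charFun μ z = ((Real.exp (-(t * |z| ^ β)) : ℝ) : ℂ)) :
    μ.map (fun x ↦ -x) = μ := by
  have : IsProbabilityMeasure (μ.map (fun x ↦ -x)) :=
    Measure.isProbabilityMeasure_map (by fun_prop)
  refine Measure.ext_of_charFun (funext fun z ↦ ?_)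
  have h := charFun_map_mul (μ := μ) (-1) z
  simp only [neg_mul, one_mul] at h
  rw [h, hμ, hμ, abs_neg]

lemma measureReal_abs_gt_le_of_charFun (hβ : 0 < β) (ht : 0 ≤ t)
    (hμ : ∀ z : ℝ, charFun μ z = ((Real.exp (-(t * |z| ^ β)) : ℝ) : ℂ)) {r : ℝ} (hr : 0 < r) :
    μ.real {x | r < |x|} ≤ 2 * t * (2 / r) ^ β := by
  have hbound : ‖∫ z in (-2 * r⁻¹)..(2 * r⁻¹), 1 - charFun μ z‖
      ≤ t * (2 / r) ^ β * |2 * r⁻¹ - -2 * r⁻¹| := by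
    refine intervalIntegral.norm_integral_le_of_norm_le_const fun z hz ↦ ?_
    have h2r : -2 * r⁻¹ ≤ 2 * r⁻¹ := by
      have := inv_pos.2 hr
      linarith
    rw [Set.uIoc_of_le h2r] at hz
    have hz' : |z| ≤ 2 / r := by
      rw [div_eq_mul_inv, abs_le]
      constructor <;> linarith [hz.1, hz.2]
    have hpow : |z| ^ β ≤ (2 / r) ^ β := Real.rpow_le_rpow (abs_nonneg _) hz' hβ.le
    have h0 : 0 ≤ t * |z| ^ β := by positivity
    rw [hμ, ← Complex.ofReal_one, ← Complex.ofReal_sub, Complex.norm_real, Real.norm_eq_abs,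
      abs_of_nonneg (by simpa using h0)]
    have := Real.add_one_le_exp (-(t * |z| ^ β))
    have := mul_le_mul_of_nonneg_left hpow ht
    linarith
  calc μ.real {x | r < |x|}
      ≤ 2⁻¹ * r * ‖∫ z in (-2 * r⁻¹)..(2 * r⁻¹), 1 - charFun μ z‖ :=
        measureReal_abs_gt_le_integral_charFun hr
    _ ≤ 2⁻¹ * r * (t * (2 / r) ^ β * |2 * r⁻¹ - -2 * r⁻¹|) := by gcongr
    _ = 2 * t * (2 / r) ^ β := by
        rw [abs_of_nonneg (by have := inv_pos.2 hr; linarith)]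
        field_simp
        ring

/-- Truncation at level `r`: the part of `1 - cos` carried by `|x| ≤ r` is controlled by
`1 - cos (x / r)`, up to the small factor `δ ^ 2`. -/
lemma one_sub_cos_le_add_indicator {δ r : ℝ} (hr : 0 < r) (x : ℝ) :
    1 - Real.cos (δ / r * x) ≤ Real.pi ^ 2 / 4 * δ ^ 2 * (1 - Real.cos (1 / r * x))
      + 2 * {x | r < |x|}.indicator 1 x := by
  by_cases hx : r < |x|
  · have h1 : ({x | r < |x|} : Set ℝ).indicator (1 : ℝ → ℝ) x = 1 := by
      simp [hx]
    rw [h1]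
    have : 0 ≤ Real.pi ^ 2 / 4 * δ ^ 2 * (1 - Real.cos (1 / r * x)) :=
      mul_nonneg (by positivity) (by linarith [Real.cos_le_one (1 / r * x)])
    linarith [Real.neg_one_le_cos (δ / r * x)]
  · have h1 : ({x | r < |x|} : Set ℝ).indicator (1 : ℝ → ℝ) x = 0 := by
      simp [hx]
    rw [h1]
    have hle : |1 / r * x| ≤ Real.pi := by
      rw [abs_mul, abs_of_pos (by positivity), one_div, inv_mul_le_iff₀ hr]
      nlinarith [Real.pi_gt_three, not_lt.1 hx]
    have h2 := Real.cos_le_one_sub_mul_cos_sq hle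
    have h3 := Real.one_sub_sq_div_two_le_cos (x := δ / r * x)
    have h4 : Real.pi ^ 2 / 4 * δ ^ 2 * (2 / Real.pi ^ 2 * (1 / r * x) ^ 2)
        = (δ / r * x) ^ 2 / 2 := by
      have := Real.pi_pos
      field_simp
      ring
    have h5 : Real.pi ^ 2 / 4 * δ ^ 2 * (2 / Real.pi ^ 2 * (1 / r * x) ^ 2)
        ≤ Real.pi ^ 2 / 4 * δ ^ 2 * (1 - Real.cos (1 / r * x)) :=
      mul_le_mul_of_nonneg_left (by linarith) (by positivity)
    linarith

/-- Since `β < 2`, the factor `δ ^ 2` of the truncation beats `δ ^ β`. -/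
lemma exists_truncation_parameter (hβ_lt : β < 2) :
    ∃ δ : ℝ, 0 < δ ∧ δ ≤ 1 ∧ Real.pi ^ 2 / 4 * δ ^ 2 ≤ δ ^ β / 4 := by
  have hlim : Tendsto (fun δ : ℝ ↦ Real.pi ^ 2 * δ ^ (2 - β)) (𝓝[>] 0) (𝓝 0) := by
    have h : Tendsto (fun δ : ℝ ↦ Real.pi ^ 2 * δ ^ (2 - β)) (𝓝 0)
        (𝓝 (Real.pi ^ 2 * 0 ^ (2 - β))) :=
      (Real.continuousAt_rpow_const _ _ (Or.inr (by linarith))).tendsto.const_mul _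
    rw [Real.zero_rpow (by linarith), mul_zero] at h
    exact h.mono_left nhdsWithin_le_nhds
  have h1 : ∀ᶠ δ : ℝ in 𝓝[>] 0, Real.pi ^ 2 * δ ^ (2 - β) < 1 :=
    hlim.eventually_lt_const one_pos
  have h2 : ∀ᶠ δ : ℝ in 𝓝[>] 0, δ ∈ Set.Ioc (0 : ℝ) 1 := Ioc_mem_nhdsGT one_pos
  obtain ⟨δ, hδ, hδ0, hδ1⟩ := (h1.and h2).exists
  refine ⟨δ, hδ0, hδ1, ?_⟩
  have hsplit : δ ^ 2 = δ ^ (2 - β) * δ ^ β := by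
    rw [← Real.rpow_add hδ0]
    simp
  rw [hsplit]
  have := mul_le_mul_of_nonneg_right hδ.le (Real.rpow_nonneg hδ0.le β)
  linarith

/-- The polynomial lower bound matching `measureReal_abs_gt_le_of_charFun`: a law with lighter
tails would have a smaller `1 - charFun` near the origin. -/
lemma le_measureReal_abs_gt_of_charFun (ht : 0 ≤ t)
    (hμ : ∀ z : ℝ, charFun μ z = ((Real.exp (-(t * |z| ^ β)) : ℝ) : ℂ)) {δ r : ℝ}
    (hδ : 0 < δ) (hδβ : Real.pi ^ 2 / 4 * δ ^ 2 ≤ δ ^ β / 4) (hr : 0 < r)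
    (hrt : t * (δ / r) ^ β ≤ 1) :
    t * (δ / r) ^ β / 8 ≤ μ.real {x | r < |x|} := by
  have hms : MeasurableSet {x : ℝ | r < |x|} := measurableSet_lt (by fun_prop) (by fun_prop)
  have hind : Integrable ({x : ℝ | r < |x|}.indicator (1 : ℝ → ℝ)) μ :=
    (integrable_const (1 : ℝ)).indicator hms
  have hmono := integral_mono (integrable_one_sub_cos_mul (μ := μ) (δ / r))
    (((integrable_one_sub_cos_mul (μ := μ) (1 / r)).const_mul (Real.pi ^ 2 / 4 * δ ^ 2)).add
      (hind.const_mul 2)) (one_sub_cos_le_add_indicator hr)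
  simp only [Pi.add_apply] at hmono
  rw [integral_add ((integrable_one_sub_cos_mul (μ := μ) (1 / r)).const_mul _) (hind.const_mul 2),
    integral_const_mul, integral_const_mul, integral_indicator_one hms, integral_one_sub_cos_mul,
    integral_one_sub_cos_mul, hμ, hμ, Complex.ofReal_re, Complex.ofReal_re,
    abs_of_pos (by positivity : 0 < δ / r), abs_of_pos (by positivity : 0 < 1 / r)] at hmono
  set y := t * (δ / r) ^ β with hy
  have hy0 : 0 ≤ y := by positivity
  have hy' : δ ^ β * (t * (1 / r) ^ β) = y := by
    rw [hy, show δ / r = δ * (1 / r) by ring, Real.mul_rpow hδ.le (by positivity)]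
    ring
  have hlow : y / 2 ≤ 1 - Real.exp (-y) := by
    have h1 : Real.exp (-y) * Real.exp y = 1 := by rw [← Real.exp_add]; simp
    have h2 := Real.add_one_le_exp y
    nlinarith [Real.exp_pos (-y)]
  have hup : 1 - Real.exp (-(t * (1 / r) ^ β)) ≤ t * (1 / r) ^ β := by
    linarith [Real.add_one_le_exp (-(t * (1 / r) ^ β))]
  have hw : 0 ≤ t * (1 / r) ^ β := by positivity
  have h1 : Real.pi ^ 2 / 4 * δ ^ 2 * (1 - Real.exp (-(t * (1 / r) ^ β)))
      ≤ δ ^ β / 4 * (t * (1 / r) ^ β) :=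
    mul_le_mul hδβ hup (by simpa using hw) (by positivity)
  linarith

end StableLaw

/-! ### The Lévy maximal inequality -/

/-- Lévy's maximal inequality for sums of independent variables. The symmetry of the increments
enters only through the probability that the sum still to come is nonnegative. -/
lemma measure_exists_lt_sum_le {Ω : Type*} [MeasurableSpace Ω] {P : Measure Ω}
    {ξ : ℕ → Ω → ℝ} (hm : ∀ i, Measurable (ξ i)) (hind : iIndepFun ξ P) (N : ℕ)
    (hmed : ∀ k ≤ N, 1 / 2 ≤ P {ω | 0 ≤ ∑ i ∈ Finset.Ico k N, ξ i ω}) (r : ℝ) :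
    P {ω | ∃ k ≤ N, r < ∑ i ∈ Finset.range k, ξ i ω}
      ≤ 2 * P {ω | r < ∑ i ∈ Finset.range N, ξ i ω} := by
  classical
  set S : ℕ → Ω → ℝ := fun k ω ↦ ∑ i ∈ Finset.range k, ξ i ω with hS
  -- `A k`: the partial sums exceed `r` for the first time at `k`
  set A : ℕ → Set Ω := fun k ↦ {ω | r < S k ω ∧ ∀ j < k, S j ω ≤ r} with hA
  set B : ℕ → Set Ω := fun k ↦ {ω | 0 ≤ ∑ i ∈ Finset.Ico k N, ξ i ω} with hB
  have hSm : ∀ k, Measurable (S k) := fun k ↦ Finset.measurable_sum _ fun i _ ↦ hm i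
  have hBm : ∀ k, MeasurableSet (B k) := fun k ↦
    measurableSet_le measurable_const (Finset.measurable_sum _ fun i _ ↦ hm i)
  have hAm : ∀ k, MeasurableSet (A k) := by
    intro k
    have : A k = {ω | r < S k ω} ∩ ⋂ j, ⋂ (_ : j < k), {ω | S j ω ≤ r} := by
      ext ω; simp [hA]
    rw [this]
    exact (measurableSet_lt measurable_const (hSm k)).inter
      (MeasurableSet.iInter fun j ↦ MeasurableSet.iInter fun _ ↦
        measurableSet_le (hSm j) measurable_const)
  have hprod : ∀ k, P (A k ∩ B k) = P (A k) * P (B k) := by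
    intro k
    let m : ℕ → MeasurableSpace Ω := fun i ↦ MeasurableSpace.comap (ξ i) inferInstance
    have hindep : Indep (⨆ i ∈ Set.Iio k, m i) (⨆ i ∈ Set.Ici k, m i) P := by
      refine indep_iSup_of_disjoint (fun i ↦ (hm i).comap_le) hind ?_
      rw [Set.disjoint_left]
      intro i hi hi'
      exact (not_lt.2 (Set.mem_Ici.1 hi')) (Set.mem_Iio.1 hi)
    have hξ : ∀ (s : Set ℕ) (i : ℕ), i ∈ s → Measurable[⨆ i ∈ s, m i] (ξ i) := fun s i hi ↦
      (comap_measurable (ξ i)).mono (le_iSup₂_of_le i hi le_rfl) le_rfl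
    have hS' : ∀ j ≤ k, Measurable[⨆ i ∈ Set.Iio k, m i] (S j) := fun j hj ↦
      Finset.measurable_sum _ fun i hi ↦
        hξ _ i (lt_of_lt_of_le (Finset.mem_range.1 hi) hj)
    refine (Indep_iff _ _ _).1 hindep (A k) (B k) ?_ ?_
    · have : A k = {ω | r < S k ω} ∩ ⋂ j, ⋂ (_ : j < k), {ω | S j ω ≤ r} := by
        ext ω; simp [hA]
      rw [this]
      refine MeasurableSet.inter (measurableSet_lt measurable_const (hS' k le_rfl))
        (MeasurableSet.iInter fun j ↦ MeasurableSet.iInter fun hj ↦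
          measurableSet_le (hS' j hj.le) measurable_const)
    · exact measurableSet_le measurable_const
        (Finset.measurable_sum _ fun i hi ↦ hξ _ i (Finset.mem_Ico.1 hi).1)
  have hdisj : ∀ i j, i < j → Disjoint (A i ∩ B i) (A j ∩ B j) := by
    intro i j hij
    rw [Set.disjoint_left]
    rintro ω ⟨hi, _⟩ ⟨hj, _⟩
    exact absurd hi.1 (not_lt.2 (hj.2 i hij))
  have hcover : {ω | ∃ k ≤ N, r < S k ω} ⊆ ⋃ k ∈ Finset.range (N + 1), A k := by
    rintro ω ⟨k, hk, hrk⟩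
    have hex : ∃ k, r < S k ω := ⟨k, hrk⟩
    simp only [Set.mem_iUnion]
    refine ⟨Nat.find hex, Finset.mem_range.2 ?_, Nat.find_spec hex, fun j hj ↦ ?_⟩
    · exact Nat.lt_succ_of_le ((Nat.find_min' hex hrk).trans hk)
    · exact not_lt.1 (Nat.find_min hex hj)
  calc P {ω | ∃ k ≤ N, r < S k ω} ≤ P (⋃ k ∈ Finset.range (N + 1), A k) := measure_mono hcover
    _ ≤ ∑ k ∈ Finset.range (N + 1), P (A k) := measure_biUnion_finset_le _ _
    _ ≤ ∑ k ∈ Finset.range (N + 1), 2 * P (A k ∩ B k) := by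
        refine Finset.sum_le_sum fun k hk ↦ ?_
        rw [hprod]
        calc P (A k) = 2 * (P (A k) * (1 / 2)) := by
              rw [mul_left_comm, one_div, ENNReal.mul_inv_cancel (by simp) (by simp), mul_one]
          _ ≤ 2 * (P (A k) * P (B k)) := by
              gcongr
              exact hmed k (Nat.lt_succ_iff.1 (Finset.mem_range.1 hk))
    _ = 2 * P (⋃ k ∈ Finset.range (N + 1), A k ∩ B k) := by
        rw [← Finset.mul_sum, measure_biUnion_finset _ fun k _ ↦ (hAm k).inter (hBm k)]
        intro i _ j _ hij
        rcases lt_or_gt_of_ne hij with h | h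
        · exact hdisj i j h
        · exact (hdisj j i h).symm
    _ ≤ 2 * P {ω | r < S N ω} := by
        gcongr
        intro ω hω
        simp only [Set.mem_iUnion] at hω
        obtain ⟨k, hk, hωA, hωB⟩ := hω
        have hsum := Finset.sum_range_add_sum_Ico (fun i ↦ ξ i ω)
          (Nat.lt_succ_iff.1 (Finset.mem_range.1 hk))
        have h1 : r < S k ω := hωA.1
        have h2 : 0 ≤ ∑ i ∈ Finset.Ico k N, ξ i ω := hωB
        simp only [Set.mem_ofPred_eq, hS] at h1 ⊢
        linarith

/-! ### The process at fixed times and along its running maximum -/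

lemma IsLevyProcess.identDistrib_sub {Ω : Type*} [MeasurableSpace Ω] {P : Measure Ω}
    {X : ℝ≥0 → Ω → ℝ} (hX : IsLevyProcess X P) {s t : ℝ≥0} (hst : s ≤ t) :
    IdentDistrib (fun ω ↦ X t ω - X s ω) (X (t - s)) P P := by
  have h := hX.stationaryIncrements s (t - s)
  rwa [add_tsub_cancel_of_le hst] at h

section StableProcess

variable {Ω : Type*} [MeasurableSpace Ω] {P : Measure Ω} [IsProbabilityMeasure P] {β : ℝ}
  {X : ℝ≥0 → Ω → ℝ}

lemma IsSymmetricStableLevyProcess.measureReal_abs_gt_le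
    (hX : IsSymmetricStableLevyProcess β X P) (hβ : 0 < β) (t : ℝ≥0) {r : ℝ} (hr : 0 < r) :
    P.real {ω | r < |X t ω|} ≤ 2 * t * (2 / r) ^ β := by
  have : IsProbabilityMeasure (P.map (X t)) :=
    Measure.isProbabilityMeasure_map (hX.measurable t).aemeasurable
  have h := measureReal_abs_gt_le_of_charFun hβ t.2 (hX.charFun_eq t) hr
  rwa [map_measureReal_apply (hX.measurable t)
    (measurableSet_lt measurable_const (by fun_prop))] at h

lemma IsSymmetricStableLevyProcess.identDistrib_neg
    (hX : IsSymmetricStableLevyProcess β X P) (t : ℝ≥0) :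
    IdentDistrib (fun ω ↦ -X t ω) (X t) P P where
  aemeasurable_fst := (hX.measurable t).neg.aemeasurable
  aemeasurable_snd := (hX.measurable t).aemeasurable
  map_eq := by
    have : IsProbabilityMeasure (P.map (X t)) :=
      Measure.isProbabilityMeasure_map (hX.measurable t).aemeasurable
    have h := map_neg_eq_of_charFun (hX.charFun_eq t)
    rwa [Measure.map_map measurable_neg (hX.measurable t)] at h

lemma IsSymmetricStableLevyProcess.half_le_measure_nonneg
    (hX : IsSymmetricStableLevyProcess β X P) (t : ℝ≥0) : 1 / 2 ≤ P {ω | 0 ≤ X t ω} := by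
  have heq : P {ω | X t ω ≤ 0} = P {ω | 0 ≤ X t ω} := by
    have h := (hX.identDistrib_neg t).measure_mem_eq (s := Set.Ici 0) measurableSet_Ici
    simpa [Set.preimage] using h
  have hle : (1 : ENNReal) ≤ P {ω | 0 ≤ X t ω} + P {ω | X t ω ≤ 0} := by
    rw [← measure_univ (μ := P)]
    exact (measure_mono fun ω _ ↦ le_total 0 (X t ω)).trans (measure_union_le _ _)
  rw [heq, ← two_mul] at hle
  exact ENNReal.div_le_of_le_mul' hle

lemma IsSymmetricStableLevyProcess.le_measureReal_gt
    (hX : IsSymmetricStableLevyProcess β X P) {δ r : ℝ} (hδ : 0 < δ)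
    (hδβ : Real.pi ^ 2 / 4 * δ ^ 2 ≤ δ ^ β / 4) (hr : 0 < r) (t : ℝ≥0)
    (hrt : t * (δ / r) ^ β ≤ 1) :
    t * (δ / r) ^ β / 16 ≤ P.real {ω | r < X t ω} := by
  have : IsProbabilityMeasure (P.map (X t)) :=
    Measure.isProbabilityMeasure_map (hX.measurable t).aemeasurable
  have h := le_measureReal_abs_gt_of_charFun t.2 (hX.charFun_eq t) hδ hδβ hr hrt
  rw [map_measureReal_apply (hX.measurable t)
    (measurableSet_lt measurable_const (by fun_prop))] at h
  have heq : P.real {ω | r < -X t ω} = P.real {ω | r < X t ω} := by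
    have h := (hX.identDistrib_neg t).measure_mem_eq (s := Set.Ioi r) measurableSet_Ioi
    simp only [Measure.real]
    exact congrArg _ h
  have hle : P.real (X t ⁻¹' {x | r < |x|})
      ≤ P.real {ω | r < X t ω} + P.real {ω | r < -X t ω} := by
    refine (measureReal_mono fun ω hω ↦ ?_).trans (measureReal_union_le _ _)
    have hω' : r < |X t ω| := hω
    exact lt_abs.1 hω'
  change (t : ℝ) * (δ / r) ^ β / 8 ≤ _ at h
  linarith

/-- The maximal inequality on the grid of mesh `h`. -/
lemma IsSymmetricStableLevyProcess.measure_exists_grid_le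
    (hX : IsSymmetricStableLevyProcess β X P) (h : ℝ≥0) (N : ℕ) (r : ℝ) :
    P {ω | ∃ k : ℕ, k ≤ N ∧ r < X (k * h) ω - X 0 ω} ≤ 2 * P {ω | r < X (N * h) ω} := by
  have hmono : Monotone fun k : ℕ ↦ (k * h : ℝ≥0) := fun i j hij ↦ by
    dsimp only
    gcongr
  have hsum : ∀ (k : ℕ) (ω : Ω), ∑ i ∈ Finset.range k,
      (X ((i + 1 : ℕ) * h) ω - X (i * h) ω) = X (k * h) ω - X 0 ω := by
    intro k ω
    rw [Finset.sum_range_sub (fun i : ℕ ↦ X (i * h) ω)]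
    simp
  have hmax := measure_exists_lt_sum_le
    (fun i ↦ (hX.measurable ((i + 1 : ℕ) * h)).sub (hX.measurable (i * h)))
    (hX.indepIncrements.nat hmono) N (fun k hk ↦ ?_) r
  · simp only [Pi.sub_apply, hsum] at hmax
    refine hmax.trans_eq ?_
    congr 1
    refine measure_congr ?_
    filter_upwards [hX.zero] with ω hω
    change (r < X (N * h) ω - X 0 ω) = (r < X (N * h) ω)
    rw [hω, sub_zero]
  · refine (hX.half_le_measure_nonneg (N * h - k * h)).trans_eq ?_
    have hid := (hX.identDistrib_sub (hmono hk)).measure_mem_eq (s := Set.Ici 0)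
      measurableSet_Ici
    refine hid.symm.trans ?_
    congr 1
    ext ω
    simp only [Set.mem_preimage, Set.mem_Ici, Set.mem_ofPred_eq, Pi.sub_apply]
    rw [Finset.sum_Ico_eq_sub _ hk, hsum, hsum, sub_sub_sub_cancel_right]

/-- A right-continuous path exceeding a level on `[0, T]` does so at a dyadic fraction of `T`. -/
lemma exists_dyadic_lt {f : ℝ≥0 → ℝ} (hf : ∀ t, ContinuousWithinAt f (Set.Ici t) t) {T s : ℝ≥0}
    (hs : s ≤ T) {r : ℝ} (hr : r < f s) :
    ∃ m k : ℕ, k ≤ 2 ^ m ∧ r < f (k * (T / 2 ^ m)) := by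
  rcases eq_or_ne T 0 with rfl | hT
  · obtain rfl : s = 0 := le_antisymm hs zero_le
    exact ⟨0, 0, by simp, by simpa using hr⟩
  have hT0 : 0 < T := pos_iff_ne_zero.2 hT
  have hev : ∀ᶠ u in 𝓝[≥] s, r < f u := (hf s).eventually_const_lt hr
  obtain ⟨v, hv, hsub⟩ := (mem_nhdsGE_iff_exists_Ico_subset' (lt_add_one s)).1 hev
  have hv : s < v := hv
  have hlim : Tendsto (fun m : ℕ ↦ T / 2 ^ m) atTop (𝓝 0) := by
    have h := (tendsto_pow_atTop_nhds_zero_of_lt_one (zero_le (a := (2⁻¹ : ℝ≥0)))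
      (inv_lt_one_of_one_lt₀ (by norm_num))).const_mul T
    simpa [div_eq_mul_inv] using h
  obtain ⟨m, hm⟩ := (hlim.eventually_lt_const (tsub_pos_of_lt hv)).exists
  set h := T / 2 ^ m with hh
  have hh0 : 0 < h := by positivity
  have hT2 : T = 2 ^ m * h := by rw [hh]; field_simp
  refine ⟨m, ⌈s / h⌉₊, ?_, hsub ⟨?_, ?_⟩⟩
  · rw [Nat.ceil_le, div_le_iff₀ hh0]
    push_cast
    rwa [← hT2]
  · exact (div_le_iff₀ hh0).1 (Nat.le_ceil _)
  · have h1 : (⌈s / h⌉₊ : ℝ≥0) < s / h + 1 := Nat.ceil_lt_add_one zero_le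
    calc (⌈s / h⌉₊ : ℝ≥0) * h < (s / h + 1) * h := by gcongr
      _ = s + h := by field_simp
      _ ≤ v := by
        rw [add_comm]
        exact (add_le_add_left hm.le s).trans_eq (tsub_add_cancel_of_le hv.le)

/-- The maximal inequality in continuous time: the dyadic grids exhaust the running maximum of a
right-continuous path. -/
lemma IsSymmetricStableLevyProcess.measure_exists_le
    (hX : IsSymmetricStableLevyProcess β X P) (T : ℝ≥0) (r : ℝ) :
    P {ω | ∃ s ≤ T, r < X s ω} ≤ 2 * P {ω | r < X T ω} := by
  set E : ℕ → Set Ω := fun m ↦ {ω | ∃ k : ℕ, k ≤ 2 ^ m ∧ r < X (k * (T / 2 ^ m)) ω - X 0 ω} with hE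
  have hmono : Monotone E := by
    refine monotone_nat_of_le_succ fun m ω ↦ ?_
    rintro ⟨k, hk, hω⟩
    refine ⟨2 * k, by rw [pow_succ']; omega, ?_⟩
    have hpt : ((2 * k : ℕ) : ℝ≥0) * (T / 2 ^ (m + 1)) = k * (T / 2 ^ m) := by
      push_cast
      rw [pow_succ']
      field_simp
    rwa [hpt]
  have hle : P {ω | ∃ s ≤ T, r < X s ω} ≤ P (⋃ m, E m) := by
    refine measure_mono_ae ?_
    filter_upwards [hX.zero, hX.cadlag] with ω h0 hc
    rintro ⟨s, hs, hrs⟩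
    obtain ⟨m, k, hk, hr⟩ := exists_dyadic_lt (fun t ↦ (hc t).1) hs hrs
    refine Set.mem_iUnion.2 ⟨m, k, hk, ?_⟩
    rwa [h0, sub_zero]
  refine hle.trans ?_
  rw [hmono.measure_iUnion]
  refine iSup_le fun m ↦ ?_
  refine (hX.measure_exists_grid_le (T / 2 ^ m) (2 ^ m) r).trans_eq ?_
  congr 4
  push_cast
  field_simp

end StableProcess

/-! ### Boundedness of the tall peaks for `1 / β < α` -/

lemma ae_eventually_notMem_of_le_summable {Ω : Type*} [MeasurableSpace Ω]
    {P : Measure Ω} {s : ℕ → Set Ω} {u : ℕ → ℝ} (hu : Summable u)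
    (hs : ∀ n, P (s n) ≤ ENNReal.ofReal (u n)) : ∀ᵐ ω ∂P, ∀ᶠ n in atTop, ω ∉ s n :=
  ae_eventually_notMem (ne_top_of_le_ne_top hu.tsum_ofReal_ne_top (ENNReal.tsum_le_tsum hs))

section TallPeaks

variable {Ω : Type*} [MeasurableSpace Ω] {P : Measure Ω} [IsProbabilityMeasure P] {β : ℝ}
  {X : ℝ≥0 → Ω → ℝ}

lemma IsSymmetricStableLevyProcess.measure_exists_le_ofReal
    (hX : IsSymmetricStableLevyProcess β X P) (hβ : 0 < β) (T : ℝ≥0) {r : ℝ} (hr : 0 < r) :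
    P {ω | ∃ s ≤ T, r < X s ω} ≤ ENNReal.ofReal (4 * T * (2 / r) ^ β) := by
  refine (hX.measure_exists_le T r).trans ?_
  have h1 : P {ω | r < X T ω} ≤ ENNReal.ofReal (2 * T * (2 / r) ^ β) := by
    rw [ENNReal.le_ofReal_iff_toReal_le (measure_ne_top _ _) (by positivity)]
    refine le_trans ?_ (hX.measureReal_abs_gt_le hβ T hr)
    exact measureReal_mono fun ω (hω : r < X T ω) ↦
      show r < |X T ω| from hω.trans_le (le_abs_self _)
  calc 2 * P {ω | r < X T ω} ≤ 2 * ENNReal.ofReal (2 * T * (2 / r) ^ β) := by gcongr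
    _ = ENNReal.ofReal (4 * T * (2 / r) ^ β) := by
        rw [show (2 : ENNReal) = ENNReal.ofReal 2 by simp,
          ← ENNReal.ofReal_mul (by norm_num)]
        congr 1
        ring

lemma IsSymmetricStableLevyProcess.ae_isBounded_tallPeaks
    (hX : IsSymmetricStableLevyProcess β X P) (hβ : 0 < β) {α : ℝ} (hα : 1 / β < α) :
    ∀ᵐ ω ∂P, Bornology.IsBounded (tallPeaks β α (fun t ↦ X t ω)) := by
  have hα0 : 0 < α := (by positivity : 0 < 1 / β).trans hα
  -- half of the least height of a tall peak over `[2 ^ (n + 1), 2 ^ (n + 2))`; halving makes the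
  -- inequality strict
  set r : ℕ → ℝ := fun n ↦ ((2 : ℝ) ^ (n + 1)) ^ (1 / β) * ((n + 1 : ℕ) : ℝ) ^ α / 2 with hr
  have hr0 : ∀ n, 0 < r n := fun n ↦ by simp only [hr]; positivity
  have hsum : Summable fun n : ℕ ↦ 8 * 4 ^ β * (((n + 1 : ℕ) : ℝ) ^ (α * β))⁻¹ := by
    have h1 : 1 < α * β := by rwa [div_lt_iff₀ hβ] at hα
    exact ((summable_nat_add_iff 1).2 (Real.summable_nat_rpow_inv.2 h1)).mul_left _
  have hbc := ae_eventually_notMem_of_le_summable (P := P) hsum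
    (s := fun n ↦ {ω | ∃ s ≤ (2 : ℝ≥0) ^ (n + 2), r n < X s ω}) fun n ↦ by
      refine (hX.measure_exists_le_ofReal hβ _ (hr0 n)).trans_eq ?_
      congr 1
      have h2 : 2 / r n = 4 / (((2 : ℝ) ^ (n + 1)) ^ (1 / β) * ((n + 1 : ℕ) : ℝ) ^ α) := by
        simp only [hr]
        field_simp
        norm_num
      rw [h2, Real.div_rpow (by norm_num) (by positivity),
        Real.mul_rpow (by positivity) (by positivity), ← Real.rpow_mul (by positivity),
        ← Real.rpow_mul (by positivity), one_div_mul_cancel hβ.ne', Real.rpow_one]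
      push_cast
      rw [pow_succ (2 : ℝ) (n + 1)]
      field_simp
      norm_num
  filter_upwards [hbc] with ω hω
  obtain ⟨n₀, hn₀⟩ := eventually_atTop.1 hω
  refine (Metric.isBounded_Icc (0 : ℝ≥0) (2 ^ (n₀ + 1))).subset fun t ht ↦ ⟨zero_le, ?_⟩
  by_contra! hlt
  have hlt' : (2 : ℝ) ^ (n₀ + 1) < t := by exact_mod_cast hlt
  obtain ⟨N, hN, hN'⟩ := exists_nat_pow_near
    ((one_le_pow₀ (by norm_num : (1 : ℝ) ≤ 2)).trans hlt'.le) (by norm_num : (1 : ℝ) < 2)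
  have hNn : n₀ + 1 < N + 1 := (pow_lt_pow_iff_right₀ (by norm_num : (1 : ℝ) < 2)).1
    (hlt'.trans hN')
  obtain ⟨n, rfl⟩ : ∃ n, N = n + 1 := ⟨N - 1, by omega⟩
  refine hn₀ n (by omega) ⟨t, by exact_mod_cast hN'.le, ?_⟩
  have hlog : ((n + 1 : ℕ) : ℝ) ≤ Real.logb 2 t := by
    rw [Real.le_logb_iff_rpow_le (by norm_num) (lt_of_lt_of_le (by positivity) hN),
      Real.rpow_natCast]
    exact hN
  have h2r : 2 * r n ≤ (t : ℝ) ^ (1 / β) * Real.logb 2 (t : ℝ) ^ α := by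
    have : 2 * r n = ((2 : ℝ) ^ (n + 1)) ^ (1 / β) * ((n + 1 : ℕ) : ℝ) ^ α := by
      simp only [hr]; ring
    rw [this]
    gcongr
  have := ht.2
  have := hr0 n
  linarith

/-! ### Unboundedness of the tall peaks for `α ≤ 1 / β` -/

/-- The large increments over dyadic intervals are independent and their probabilities have a
divergent sum. -/
lemma IsSymmetricStableLevyProcess.ae_frequently_large_increment
    (hX : IsSymmetricStableLevyProcess β X P) (hβ : 0 < β) (hβ_lt : β < 2) {K : ℝ} (hK : 1 ≤ K) :
    ∀ᵐ ω ∂P, ∃ᶠ n : ℕ in atTop, K * ((2 : ℝ) ^ n * (n + 1)) ^ (1 / β)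
      < X (2 ^ (n + 1)) ω - X (2 ^ n) ω := by
  set a : ℕ → ℝ := fun n ↦ ((2 : ℝ) ^ n * (n + 1)) ^ (1 / β) with ha
  have ha0 : ∀ n, 0 < a n := fun n ↦ by simp only [ha]; positivity
  have hmono : Monotone fun n : ℕ ↦ (2 : ℝ≥0) ^ n := pow_right_mono₀ (by norm_num)
  have hDm : ∀ n : ℕ, Measurable fun ω ↦ X (2 ^ (n + 1)) ω - X (2 ^ n) ω := fun n ↦
    (hX.measurable _).sub (hX.measurable _)
  set A : ℕ → Set Ω := fun n ↦ {ω | K * a n < X (2 ^ (n + 1)) ω - X (2 ^ n) ω} with hA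
  have hAm : ∀ n, MeasurableSet (A n) := fun n ↦ measurableSet_lt measurable_const (hDm n)
  have hind : iIndepSet A P := by
    rw [iIndepSet_iff_meas_biInter hAm]
    intro s
    exact (hX.indepIncrements.nat hmono).meas_biInter (S := s)
      fun n _ ↦ ⟨Set.Ioi (K * a n), measurableSet_Ioi, rfl⟩
  obtain ⟨δ, hδ, hδ1, hδβ⟩ := exists_truncation_parameter hβ_lt
  have hPA : ∀ n : ℕ, ENNReal.ofReal ((δ / K) ^ β / 16 * (1 / ((n : ℝ) + 1))) ≤ P (A n) := by
    intro n
    have hpow : (δ / (K * a n)) ^ β = (δ / K) ^ β / ((2 : ℝ) ^ n * (n + 1)) := by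
      rw [← div_div, Real.div_rpow (by positivity) (ha0 n).le]
      simp only [ha]
      rw [← Real.rpow_mul (by positivity), one_div_mul_cancel hβ.ne', Real.rpow_one]
    have hmul : (((2 : ℝ≥0) ^ n : ℝ≥0) : ℝ) * (δ / (K * a n)) ^ β
        = (δ / K) ^ β * (1 / ((n : ℝ) + 1)) := by
      rw [hpow]
      push_cast
      field_simp
    have hone : (δ / K) ^ β * (1 / ((n : ℝ) + 1)) ≤ 1 := by
      refine mul_le_one₀ (Real.rpow_le_one (by positivity) ?_ hβ.le) (by positivity) ?_
      · rw [div_le_one₀ (by positivity)]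
        exact hδ1.trans hK
      · rw [div_le_one₀ (by positivity)]
        have : (0 : ℝ) ≤ n := by positivity
        linarith
    have hlow := hX.le_measureReal_gt hδ hδβ (by have := ha0 n; positivity) (2 ^ n)
      (hmul.trans_le hone)
    rw [hmul] at hlow
    have hsub : (2 : ℝ≥0) ^ (n + 1) - 2 ^ n = 2 ^ n := by
      rw [pow_succ, mul_two, add_tsub_cancel_right]
    have hid := (hX.identDistrib_sub (hmono n.le_succ)).measure_mem_eq (s := Set.Ioi (K * a n))
      measurableSet_Ioi
    dsimp only [Nat.succ_eq_add_one] at hid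
    rw [hsub] at hid
    refine (ENNReal.ofReal_le_iff_le_toReal (measure_ne_top _ _)).2 ?_
    change _ ≤ (P ((fun ω ↦ X (2 ^ (n + 1)) ω - X (2 ^ n) ω) ⁻¹' Set.Ioi (K * a n))).toReal
    rw [hid]
    change _ ≤ P.real {ω | K * a n < X (2 ^ n) ω}
    linarith
  have htop : ∑' n, P (A n) = ⊤ := by
    by_contra hne
    have hsum := ENNReal.summable_toReal hne
    have hc : 0 < (δ / K) ^ β / 16 := by positivity
    have hle : Summable fun n : ℕ ↦ (δ / K) ^ β / 16 * (1 / ((n : ℝ) + 1)) :=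
      hsum.of_nonneg_of_le (fun n ↦ by positivity) fun n ↦
        (ENNReal.ofReal_le_iff_le_toReal (measure_ne_top _ _)).1 (hPA n)
    rw [summable_mul_left_iff hc.ne'] at hle
    refine Real.not_summable_one_div_natCast ((summable_nat_add_iff 1).1 ?_)
    simpa using hle
  have hone := measure_limsup_eq_one hAm hind htop
  have hae : ∀ᵐ ω ∂P, ω ∈ limsup A atTop :=
    (mem_ae_iff_prob_eq_one (MeasurableSet.measurableSet_limsup hAm)).2 hone
  filter_upwards [hae] with ω hω
  exact mem_limsup_iff_frequently_mem.1 hω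

/-- Each of the two conditions holds with probability `O(1 / n)`; by independence the
joint event has probability `O(1 / n ^ 2)`. -/
lemma IsSymmetricStableLevyProcess.ae_eventually_not_large_increment_and_low
    (hX : IsSymmetricStableLevyProcess β X P) (hβ : 0 < β) {K : ℝ} (hK : 1 ≤ K) :
    ∀ᵐ ω ∂P, ∀ᶠ n : ℕ in atTop, ¬ (X (2 ^ n) ω < -((2 : ℝ) ^ n * (n + 1)) ^ (1 / β) ∧
      K * ((2 : ℝ) ^ n * (n + 1)) ^ (1 / β) < X (2 ^ (n + 1)) ω - X (2 ^ n) ω) := by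
  set a : ℕ → ℝ := fun n ↦ ((2 : ℝ) ^ n * (n + 1)) ^ (1 / β) with ha
  have ha0 : ∀ n, 0 < a n := fun n ↦ by simp only [ha]; positivity
  have hmono : Monotone fun n : ℕ ↦ (2 : ℝ≥0) ^ n := pow_right_mono₀ (by norm_num)
  have htail : ∀ n : ℕ, P {ω | a n < |X (2 ^ n) ω|}
      ≤ ENNReal.ofReal (2 * 2 ^ β * (1 / ((n : ℝ) + 1))) := by
    intro n
    rw [ENNReal.le_ofReal_iff_toReal_le (measure_ne_top _ _) (by positivity)]
    refine (hX.measureReal_abs_gt_le hβ (2 ^ n) (ha0 n)).trans_eq ?_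
    rw [Real.div_rpow (by norm_num) (ha0 n).le]
    simp only [ha]
    rw [← Real.rpow_mul (by positivity), one_div_mul_cancel hβ.ne', Real.rpow_one]
    push_cast
    field_simp
  have hsum : Summable fun n : ℕ ↦
      (2 * (2 : ℝ) ^ β * (1 / ((n : ℝ) + 1))) * (2 * 2 ^ β * (1 / ((n : ℝ) + 1))) := by
    have h := ((summable_nat_add_iff 1).2
      (Real.summable_one_div_nat_pow.2 (by norm_num : 1 < 2))).mul_left ((2 * (2 : ℝ) ^ β) ^ 2)
    refine h.congr fun n ↦ ?_
    push_cast
    field_simp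
  refine ae_eventually_notMem_of_le_summable (P := P) hsum (s := fun n ↦
    {ω | X (2 ^ n) ω < -a n ∧ K * a n < X (2 ^ (n + 1)) ω - X (2 ^ n) ω}) fun n ↦ ?_
  have hindep := hX.indepIncrements.indepFun_eval_sub (r := 0) (s := 2 ^ n) (t := 2 ^ (n + 1))
    zero_le (hmono n.le_succ) hX.zero
  have hprod := hindep.measure_inter_preimage_eq_mul (Set.Iio (-a n)) (Set.Ioi (K * a n))
    measurableSet_Iio measurableSet_Ioi
  refine hprod.trans_le ?_
  rw [ENNReal.ofReal_mul (by positivity)]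
  have hsub : (2 : ℝ≥0) ^ (n + 1) - 2 ^ n = 2 ^ n := by
    rw [pow_succ, mul_two, add_tsub_cancel_right]
  have hid := (hX.identDistrib_sub (hmono n.le_succ)).measure_mem_eq (s := Set.Ioi (K * a n))
    measurableSet_Ioi
  dsimp only [Nat.succ_eq_add_one] at hid
  rw [hsub] at hid
  refine mul_le_mul' ((measure_mono fun ω hω ↦ ?_).trans (htail n)) ?_
  · have hω' : X (2 ^ n) ω < -a n := hω
    change a n < |X (2 ^ n) ω|
    exact lt_abs.2 (Or.inr (by linarith))
  · refine hid.trans_le ((measure_mono fun ω hω ↦ ?_).trans (htail n))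
    have hω' : K * a n < X (2 ^ n) ω := hω
    change a n < |X (2 ^ n) ω|
    exact lt_abs.2 (Or.inl (lt_of_le_of_lt (le_mul_of_one_le_left (ha0 n).le hK) hω'))

lemma IsSymmetricStableLevyProcess.ae_not_isBounded_tallPeaks
    (hX : IsSymmetricStableLevyProcess β X P) (hβ : 0 < β) (hβ_lt : β < 2) {α : ℝ}
    (hα : α ≤ 1 / β) :
    ∀ᵐ ω ∂P, ¬ Bornology.IsBounded (tallPeaks β α (fun t ↦ X t ω)) := by
  -- with this constant, an increment over `[2 ^ n, 2 ^ (n + 1)]` starting above minus the unit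
  -- scale ends at the height of a tall peak at time `2 ^ (n + 1)`
  have hK : (1 : ℝ) ≤ 1 + 2 ^ (1 / β) := by
    have : (0 : ℝ) < 2 ^ (1 / β) := by positivity
    linarith
  filter_upwards [hX.ae_frequently_large_increment hβ hβ_lt hK,
    hX.ae_eventually_not_large_increment_and_low hβ hK] with ω hfreq hev hbdd
  obtain ⟨M, hM⟩ := hbdd.bddAbove
  have hlarge : ∀ᶠ n : ℕ in atTop, M < (2 : ℝ≥0) ^ (n + 1) :=
    ((tendsto_pow_atTop_atTop_of_one_lt (by norm_num : (1 : ℝ≥0) < 2)).comp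
      (tendsto_add_atTop_nat 1)).eventually_gt_atTop M
  obtain ⟨n, hn, hlow, hMn, hn1⟩ :=
    (hfreq.and_eventually (hev.and (hlarge.and (eventually_ge_atTop 1)))).exists
  have hlow' : -((2 : ℝ) ^ n * (n + 1)) ^ (1 / β) ≤ X (2 ^ n) ω :=
    not_lt.1 fun h ↦ hlow ⟨h, hn⟩
  refine absurd (hM (a := 2 ^ (n + 1)) ⟨?_, ?_⟩) (not_le.2 hMn)
  · have h4 : (2 : ℝ) ^ 2 ≤ 2 ^ (n + 1) := pow_le_pow_right₀ (by norm_num) (by omega)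
    push_cast
    have := Real.exp_one_lt_d9
    linarith
  · have hlog : Real.logb 2 ((2 : ℝ) ^ (n + 1)) = n + 1 := by
      rw [← Real.rpow_natCast, Real.logb_rpow (by norm_num) (by norm_num)]
      push_cast
      rfl
    push_cast
    rw [hlog]
    calc ((2 : ℝ) ^ (n + 1)) ^ (1 / β) * ((n : ℝ) + 1) ^ α
        ≤ ((2 : ℝ) ^ (n + 1)) ^ (1 / β) * ((n : ℝ) + 1) ^ (1 / β) := by
          gcongr
          have : (0 : ℝ) ≤ n := by positivity
          linarith
      _ = 2 ^ (1 / β) * ((2 : ℝ) ^ n * (n + 1)) ^ (1 / β) := by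
          rw [← Real.mul_rpow (by positivity) (by positivity),
            ← Real.mul_rpow (by positivity) (by positivity), pow_succ]
          congr 1
          ring
      _ ≤ X (2 ^ (n + 1)) ω := by
          rw [add_mul, one_mul] at hn
          linarith

end TallPeaks

theorem mainTheorem10 {Ω : Type*} [MeasurableSpace Ω] (P : Measure Ω) [IsProbabilityMeasure P]
    (β : ℝ) (hβ_pos : 0 < β) (hβ_lt : β < 2) (X : ℝ≥0 → Ω → ℝ)
    (hX : IsSymmetricStableLevyProcess β X P) (α : ℝ) :
    (0 < α → α ≤ 1 / β →
      ∀ᵐ ω ∂P, ¬ Bornology.IsBounded (tallPeaks β α (fun t ↦ X t ω))) ∧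
    (1 / β < α →
      ∀ᵐ ω ∂P, Bornology.IsBounded (tallPeaks β α (fun t ↦ X t ω))) :=
  ⟨fun _ hα ↦ hX.ae_not_isBounded_tallPeaks hβ_pos hβ_lt hα,
    fun hα ↦ hX.ae_isBounded_tallPeaks hβ_pos hα⟩
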